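/- Let $\mathcal G=(S,B)$ be a simple, countable, connected graph of bounded degree with path metric $d$ and balls $B_n(s)=\{t\in S: d(s,t)\le n\}$. Its exponential growth rate is the infimum $\theta$ of all $\theta'\ge 0$ for which there is a constant $K$ with $|B_n(s)|\le K e^{\theta' n}$ for all $s\in S$ and $n\in\mathbb N_0$. Let $E$ be a finite set, let $\Omega=E^S$ carry the product $\sigma$-algebra, and for $U\subseteq S$ let $\mathcal F_U$ be the $\sigma$-algebra generated by the coordinates in $U$. Let $\mu$ be a probability measure on $\Omega$, and for finite $\Lambda\subseteq S$ let $\mu_\Lambda^\omega$ denote the regular conditional probability on $\mathcal F_\Lambda$ given $\mathcal F_{\Lambda^c}$. Call $\mu$ non-degenerate if for every finite $\Lambda\subseteq S$ and every $A\in\mathcal F_\Lambda$ with $\mu(A)>0$ one has $\mu_\Lambda^\omega(A)>0$ for $\mu$-almost all $\omega$. For $k\in\mathbb N_0$ put $\partial_k\Lambda=\{s\in\Lambda^c: d(s,t)\le k\text{ for some }t\in\Lambda\}$, and call $\mu$ $k$-Markovian if for every finite $\Lambda\subseteq S$ and $\mu$-almost all $\omega,\tau$, $\omega_{\partial_k\Lambda}=\tau_{\partial_k\Lambda}$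 implies $\mu_\Lambda^\omega=\mu_\Lambda^\tau$. For $U,V\subseteq S$ let $$\varphi(U,V)=\sup|\mu(A\mid B)-\mu(A)|,\qquad \psi(U,V)=\sup\left|\frac{\mu(A\cap B)}{\mu(A)\mu(B)}-1\right|,$$ the suprema being over $A\in\mathcal F_U$, $B\in\mathcal F_V$ of positive measure, and for $\lambda>0$ let $\Sigma(\lambda,U,V)=\sum_{t\in U}\sum_{s\in V}e^{-\lambda d(t,s)}\in[0,\infty]$. For $\pi\in\{\varphi,\psi\}$ call $\mu$ $\pi$-mixing with exponential decay rate $\lambda$ if there is a constant $C\ge1$ such that $\pi(U,V)\le C\,\Sigma(\lambda,U,V)$ for all $U,V\subseteq S$ with $C\,\Sigma(\lambda,U,V)<1$. **Theorem.** Let $\mu$ be non-degenerate, let $\lambda>3\theta$ and let $k\in\mathbb N_0$. If $\mu$ is $k$-Markovian and $\varphi$-mixing with exponential decay rate $\lambda$, then $\mu$ is $\psi$-mixing with exponential decay rate $(\lambda-3\theta)/9$. -/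

import Mathlib

open MeasureTheory ProbabilityTheory
open scoped ENNReal NNReal

namespace RandomField

/-! ### Graphs. Distances are `G.dist`, the path metric of a connected graph. -/

section Graph

variable {S : Type*}

/-- All degrees are bounded by one constant. -/
def HasBoundedDegree (G : SimpleGraph S) : Prop :=
  ∃ d : ℕ, ∀ s : S, (G.neighborSet s).encard ≤ d

/-- The closed ball of radius `n` around `s` in the path metric. -/
def ball (G : SimpleGraph S) (s : S) (n : ℕ) : Set S :=
  {t | G.dist s t ≤ n}

/-- The `k`-boundary: the sites outside `Λ` at distance at most `k` from `Λ`. -/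
def kBoundary (G : SimpleGraph S) (k : ℕ) (Λ : Set S) : Set S :=
  {s | s ∉ Λ ∧ ∃ t ∈ Λ, G.dist s t ≤ k}

/-- Balls grow at most like `e ^ (θ n)`, uniformly in the centre and up to a multiplicative
constant. -/
def HasExpGrowthBound (G : SimpleGraph S) (θ : ℝ) : Prop :=
  ∃ K : ℝ, ∀ (s : S) (n : ℕ),
    (ball G s n).Finite ∧ ((ball G s n).ncard : ℝ) ≤ K * Real.exp (θ * n)

/-- The exponential growth rate: the infimum of all `θ ∈ [0, ∞)` for which balls grow at most like
`e ^ (θ n)`. In particular it is `0` for graphs of polynomial growth. -/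
noncomputable def growthRate (G : SimpleGraph S) : ℝ :=
  sInf {θ : ℝ | 0 ≤ θ ∧ HasExpGrowthBound G θ}

/-- If `|B_n(s)| ≤ e ^ (θ n)` for all `s` and all `n`, without any constant, then the growth rate
is at most `θ`. -/
theorem growthRate_le_of_ball_bound (G : SimpleGraph S) {θ : ℝ} (hθ : 0 ≤ θ)
    (h : ∀ (s : S) (n : ℕ),
      (ball G s n).Finite ∧ ((ball G s n).ncard : ℝ) ≤ Real.exp (θ * n)) :
    growthRate G ≤ θ :=
  csInf_le ⟨0, fun _ hx => hx.1⟩ ⟨hθ, 1, fun s n => ⟨(h s n).1, by simpa using (h s n).2⟩⟩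

/-- `Σ(λ, U, V) = ∑_{t ∈ U} ∑_{s ∈ V} e ^ (-λ d(t, s))`, with values in `[0, ∞]`. -/
noncomputable def expSum (G : SimpleGraph S) (lam : ℝ) (U V : Set S) : ℝ≥0∞ :=
  ∑' t : U, ∑' s : V, ENNReal.ofReal (Real.exp (-lam * G.dist (t : S) (s : S)))

/-- For a mixing coefficient `π` this says that the field is `π`-mixing with exponential decay rate
`lam`. -/
def IsExpMixing (G : SimpleGraph S) (π : Set S → Set S → ℝ≥0∞) (lam : ℝ) : Prop :=
  ∃ C : ℝ≥0, 1 ≤ C ∧ ∀ U V : Set S,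
    C * expSum G lam U V < 1 → π U V ≤ C * expSum G lam U V

end Graph

/-! ### Random fields in canonical form: probability measures on `S → E`. The σ-algebra generated by
the coordinates in `U` is `cylinderEvents U`. -/

section Field

variable {S E : Type*} [MeasurableSpace E]

/-- The mixing coefficient that belongs to a measure of dependence `δ`: the supremum of `δ A B` over
events `A` of `U` and `B` of `V` of positive measure. -/
noncomputable def mixingCoeff (μ : Measure (S → E)) (δ : Set (S → E) → Set (S → E) → ℝ)
    (U V : Set S) : ℝ≥0∞ :=
  ⨆ (A : Set (S → E)) (B : Set (S → E))
    (_ : MeasurableSet[cylinderEvents U] A) (_ : MeasurableSet[cylinderEvents V] B)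
    (_ : 0 < μ A) (_ : 0 < μ B), ENNReal.ofReal (δ A B)

/-- `δ_φ(A, B) = |μ(A | B) - μ(A)|`. -/
noncomputable def phiDep (μ : Measure (S → E)) (A B : Set (S → E)) : ℝ :=
  |(μ[|B]).real A - μ.real A|

/-- `δ_ψ(A, B) = |μ(A ∩ B) / (μ(A) μ(B)) - 1|`. -/
noncomputable def psiDep (μ : Measure (S → E)) (A B : Set (S → E)) : ℝ :=
  |μ.real (A ∩ B) / (μ.real A * μ.real B) - 1|

/-- `φ`-mixing with exponential decay rate `lam`. -/
def IsPhiMixing (G : SimpleGraph S) (μ : Measure (S → E)) (lam : ℝ) : Prop :=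
  IsExpMixing G (mixingCoeff μ (phiDep μ)) lam

/-- `ψ`-mixing with exponential decay rate `lam`. -/
def IsPsiMixing (G : SimpleGraph S) (μ : Measure (S → E)) (lam : ℝ) : Prop :=
  IsExpMixing G (mixingCoeff μ (psiDep μ)) lam

variable [Countable S] [Finite E] [MeasurableSingletonClass E]

/-- The regular conditional probability `μ_Λ^ω`, for finite `Λ`: the conditional distribution, given
the coordinates outside `Λ`, as a measure on the σ-algebra generated by the coordinates in `Λ`. -/
noncomputable def localCond (μ : Measure (S → E)) [IsProbabilityMeasure μ] (Λ : Finset S)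
    (ω : S → E) : @Measure (S → E) (cylinderEvents (Λ : Set S)) :=
  (condExpKernel μ (cylinderEvents (Λ : Set S)ᶜ) ω).trim cylinderEvents_le_pi

/-- `μ_Λ^ω(A)` is a version of the conditional probability of `A` given the coordinates outside
`Λ`. -/
theorem localCond_ae_eq (μ : Measure (S → E)) [IsProbabilityMeasure μ] (Λ : Finset S)
    {A : Set (S → E)} (hA : MeasurableSet[cylinderEvents (Λ : Set S)] A) :
    (fun ω => (localCond μ Λ ω A).toReal) =ᵐ[μ] μ⟦A | cylinderEvents (Λ : Set S)ᶜ⟧ := by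
  have h := condExpKernel_ae_eq_condExp (μ := μ)
    (cylinderEvents_le_pi (X := fun _ : S => E) (Δ := (Λ : Set S)ᶜ)) (cylinderEvents_le_pi _ hA)
  filter_upwards [h] with ω hω
  rw [← hω, localCond, trim_measurableSet_eq _ hA]
  rfl

/-- Non-degeneracy: an event of finitely many sites that has positive probability has positive
conditional probability under almost every configuration outside. -/
def IsNonDegenerate (μ : Measure (S → E)) [IsProbabilityMeasure μ] : Prop :=
  ∀ (Λ : Finset S) (A : Set (S → E)), MeasurableSet[cylinderEvents (Λ : Set S)] A →
    0 < μ A → ∀ᵐ ω ∂μ, 0 < localCond μ Λ ω A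

/-- The `k`-Markov property: for finite `Λ` and almost all `ω`, `τ` that agree on the `k`-boundary
of `Λ`, the measures `μ_Λ^ω` and `μ_Λ^τ` agree. -/
def IsMarkovian (G : SimpleGraph S) (k : ℕ) (μ : Measure (S → E)) [IsProbabilityMeasure μ] :
    Prop :=
  ∀ Λ : Finset S, ∀ᵐ ω ∂μ, ∀ᵐ τ ∂μ,
    (∀ s ∈ kBoundary G k (Λ : Set S), ω s = τ s) → localCond μ Λ ω = localCond μ Λ τ

end Field

end RandomField

/-!
Let `A` and `B` be events of `U` and `V`, and let `D` be the `k`-boundary of a finite set `Λ` that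
contains `U` and does not meet `V`. By the Markov property `A` and `B` are conditionally independent
given the configuration `w` on `D`, so that `μ (A ∩ B) / (μ A * μ B)` is the mean of `f w * g w`,
where `f w = μ(A | w) / μ A` and `g w = μ(B | w) / μ B` have mean `1`. Let `ε = s ^ 2` be the bound
for `φ(D, U ∪ V)`. Conditioning on `A` or on `B` changes the law of `w` by at most `ε`, so `f` and
`g` are within `s` of `1` outside a bad set of probability at most `4 * s`. On the bad set
`f * g` need not be bounded, but `φ`-mixing applies to the condition `A ∩ B` as well: the bad set
carries at most the fraction `4 * s + ε` of the mean of `f * g`. Hence this mean is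
`1 + O(s)` (`abs_sub_mul_le_of_weights`, `IsMarkovian.abs_sub_le_of_separation`).

For finite `U`, the set `Λ` is the Voronoi cell of `U` against `V`, truncated at a large distance
from `U` to make it finite (`voronoiCell`). A site `t` of its boundary is about equally far from `U`
and from `V`, so `d(t, u) ≥ d(u, v) / 2` up to a constant for some `v`. Summing over `t` costs the
growth rate, which leads to `ε ≤ M * Σ(2 r, U, V) ≤ M * Σ(r, U, V) ^ 2` with
`r = (lam - 3 * growthRate G) / 9` (`expSum_kBoundary_voronoiCell_le`, `expSum_two_mul_le_sq`), and
`s` is of the order of `Σ(r, U, V)`. Infinite `U` are reached by approximating `A` by events of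
finitely many coordinates (`abs_sub_le_of_forall_finset`).
-/

namespace RandomField

/-! ### An inequality for weights on a finite set -/

open Finset in
/-- Let `p`, `a`, `b`, `c` be the weights of the values `w` of a finite-valued variable, alone and
jointly with events of probability `α`, `β` and with their intersection, of probability `γ`. If the
events are conditionally independent given the variable, and conditioning on any of the three events
changes the distribution of the variable by at most `s ^ 2`, then `γ` is close to `α * β`. Call `w`
bad if `a w / p w` deviates from `α` by more than the relative error `s`, or likewise for `b` and
`β`. The bad `w` have probability at most `4 * s`, and at most `4 * s + s ^ 2` conditionally on the
intersection; the good ones satisfy `c w ≈ α * β * p w`. -/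
theorem abs_sub_mul_le_of_weights {W : Type*} [Fintype W] {p a b c : W → ℝ} {α β γ s : ℝ}
    (hs0 : 0 < s) (hs1 : s ≤ 1 / 10) (hα : 0 < α) (hβ : 0 < β)
    (hp : ∀ w, 0 ≤ p w) (ha : ∀ w, 0 ≤ a w) (hc : ∀ w, 0 ≤ c w) (hcp : ∀ w, c w ≤ p w)
    (hp1 : ∑ w, p w = 1) (hcγ : ∑ w, c w = γ) (hmul : ∀ w, c w * p w = a w * b w)
    (hA : ∀ P : Finset W, |∑ w ∈ P, a w - α * ∑ w ∈ P, p w| ≤ s ^ 2 * α)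
    (hB : ∀ P : Finset W, |∑ w ∈ P, b w - β * ∑ w ∈ P, p w| ≤ s ^ 2 * β)
    (hC : ∀ P : Finset W, |∑ w ∈ P, c w - γ * ∑ w ∈ P, p w| ≤ s ^ 2 * γ) :
    |γ - α * β| ≤ 15 * s * (α * β) := by
  classical
  -- On a set of values with excess at least `s * x * p w`, the total excess is at most `s ^ 2 * x`,
  -- so that set has weight at most `s`; the same holds for deficits.
  have bad : ∀ (f : W → ℝ) (x : ℝ), 0 < x →
      (∀ P : Finset W, |∑ w ∈ P, f w - x * ∑ w ∈ P, p w| ≤ s ^ 2 * x) →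
      ∑ w with ¬ |f w - x * p w| ≤ s * x * p w, p w ≤ 2 * s := by
    intro f x hx hf
    have hsub : (univ.filter fun w => ¬ |f w - x * p w| ≤ s * x * p w) ⊆
        (univ.filter fun w => s * x * p w ≤ f w - x * p w) ∪
          (univ.filter fun w => s * x * p w ≤ x * p w - f w) := by
      intro w hw
      simp only [mem_filter, mem_univ, true_and, not_le, mem_union, lt_abs] at hw ⊢
      rcases hw with h | h
      · exact Or.inl h.le
      · right; linarith
    have h1 : ∑ w with s * x * p w ≤ f w - x * p w, p w ≤ s := by
      have h := (abs_le.1 (hf (univ.filter fun w => s * x * p w ≤ f w - x * p w))).2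
      have h' : ∑ w with s * x * p w ≤ f w - x * p w, s * x * p w ≤
          ∑ w with s * x * p w ≤ f w - x * p w, (f w - x * p w) :=
        sum_le_sum fun w hw => (mem_filter.1 hw).2
      rw [← mul_sum, sum_sub_distrib, ← mul_sum] at h'
      have : s * x * ∑ w with s * x * p w ≤ f w - x * p w, p w ≤ s * x * s := by linarith
      exact le_of_mul_le_mul_left this (by positivity)
    have h2 : ∑ w with s * x * p w ≤ x * p w - f w, p w ≤ s := by
      have h := (abs_le.1 (hf (univ.filter fun w => s * x * p w ≤ x * p w - f w))).1
      have h' : ∑ w with s * x * p w ≤ x * p w - f w, s * x * p w ≤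
          ∑ w with s * x * p w ≤ x * p w - f w, (x * p w - f w) :=
        sum_le_sum fun w hw => (mem_filter.1 hw).2
      rw [← mul_sum, sum_sub_distrib, ← mul_sum] at h'
      have : s * x * ∑ w with s * x * p w ≤ x * p w - f w, p w ≤ s * x * s := by linarith
      exact le_of_mul_le_mul_left this (by positivity)
    have h3 := (sum_le_sum_of_subset_of_nonneg hsub (f := p) fun w _ _ => hp w)
    have h4 := sum_union_inter (f := p)
      (s₁ := univ.filter fun w => s * x * p w ≤ f w - x * p w)
      (s₂ := univ.filter fun w => s * x * p w ≤ x * p w - f w)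
    have h5 := sum_nonneg (s := (univ.filter fun w => s * x * p w ≤ f w - x * p w) ∩
      (univ.filter fun w => s * x * p w ≤ x * p w - f w)) fun w _ => hp w
    linarith
  set N : Finset W := univ.filter fun w => |a w - α * p w| ≤ s * α * p w ∧
    |b w - β * p w| ≤ s * β * p w with hN
  have hbad : ∑ w ∈ Nᶜ, p w ≤ 4 * s := by
    have hsub : Nᶜ ⊆ (univ.filter fun w => ¬ |a w - α * p w| ≤ s * α * p w) ∪
        (univ.filter fun w => ¬ |b w - β * p w| ≤ s * β * p w) := by
      intro w hw
      simp only [hN, mem_compl, mem_filter, mem_univ, true_and, mem_union] at hw ⊢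
      tauto
    have h3 := (sum_le_sum_of_subset_of_nonneg hsub (f := p) fun w _ _ => hp w)
    have h4 := sum_union_inter (f := p)
      (s₁ := univ.filter fun w => ¬ |a w - α * p w| ≤ s * α * p w)
      (s₂ := univ.filter fun w => ¬ |b w - β * p w| ≤ s * β * p w)
    have h5 := sum_nonneg (s := (univ.filter fun w => ¬ |a w - α * p w| ≤ s * α * p w) ∩
      (univ.filter fun w => ¬ |b w - β * p w| ≤ s * β * p w)) fun w _ => hp w
    have := bad a α hα hA
    have := bad b β hβ hB
    linarith
  have hgood : ∀ w ∈ N, (1 - s) ^ 2 * (α * β) * p w ≤ c w ∧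
      c w ≤ (1 + s) ^ 2 * (α * β) * p w := by
    intro w hw
    simp only [hN, mem_filter, mem_univ, true_and, abs_le] at hw
    obtain ⟨⟨ha1, ha2⟩, hb1, hb2⟩ := hw
    rcases (hp w).eq_or_lt with h0 | h0
    · have h1 : c w = 0 := le_antisymm (h0 ▸ hcp w) (hc w)
      simp [← h0, h1]
    · have hl : (1 - s) * α * p w * ((1 - s) * β * p w) ≤ a w * b w := by
        apply mul_le_mul (by linarith) (by linarith) _ (ha w)
        have : 0 ≤ 1 - s := by linarith
        positivity
      have hb0 : 0 ≤ b w := by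
        have : 0 ≤ (1 - s) * β * p w := by
          have : 0 ≤ 1 - s := by linarith
          positivity
        linarith
      have hu : a w * b w ≤ (1 + s) * α * p w * ((1 + s) * β * p w) :=
        mul_le_mul (by linarith) (by linarith) hb0 (by positivity)
      rw [← hmul] at hl hu
      constructor
      · exact le_of_mul_le_mul_right (by linarith) h0
      · exact le_of_mul_le_mul_right (by linarith) h0
  have hpN : ∑ w ∈ N, p w + ∑ w ∈ Nᶜ, p w = 1 := by rw [sum_add_sum_compl, hp1]
  have hcN : ∑ w ∈ N, c w + ∑ w ∈ Nᶜ, c w = γ := by rw [sum_add_sum_compl, hcγ]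
  have hcN0 : 0 ≤ ∑ w ∈ Nᶜ, c w := sum_nonneg fun w _ => hc w
  have hpN0 : 0 ≤ ∑ w ∈ Nᶜ, p w := sum_nonneg fun w _ => hp w
  have hγ : 0 ≤ γ := hcγ ▸ sum_nonneg fun w _ => hc w
  have hlow : (1 - s) ^ 2 * (α * β) * ∑ w ∈ N, p w ≤ ∑ w ∈ N, c w := by
    rw [mul_sum]; exact sum_le_sum fun w hw => (hgood w hw).1
  have hupp : ∑ w ∈ N, c w ≤ (1 + s) ^ 2 * (α * β) * ∑ w ∈ N, p w := by
    rw [mul_sum]; exact sum_le_sum fun w hw => (hgood w hw).2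
  have hαβ : 0 < α * β := mul_pos hα hβ
  -- Nothing bounds `c w` pointwise at bad values `w`; only their total is controlled, through `hC`.
  have hcbad : ∑ w ∈ Nᶜ, c w ≤ γ * (4 * s + s ^ 2) := by
    have h := (abs_le.1 (hC Nᶜ)).2
    nlinarith [mul_le_mul_of_nonneg_left hbad hγ]
  have hu : γ * (1 - 4 * s - s ^ 2) ≤ (1 + s) ^ 2 * (α * β) := by
    have : (1 + s) ^ 2 * (α * β) * ∑ w ∈ N, p w ≤ (1 + s) ^ 2 * (α * β) * 1 :=
      mul_le_mul_of_nonneg_left (by linarith) (by positivity)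
    linarith
  have hl : (1 - s) ^ 2 * (α * β) * (1 - 4 * s) ≤ γ :=
    calc _ ≤ (1 - s) ^ 2 * (α * β) * ∑ w ∈ N, p w :=
          mul_le_mul_of_nonneg_left (by linarith) (by positivity)
      _ ≤ γ := by linarith
  rw [abs_le]
  constructor
  · have h1 : 1 - 15 * s ≤ (1 - s) ^ 2 * (1 - 4 * s) := by nlinarith [sq_nonneg s]
    have := mul_le_mul_of_nonneg_right h1 hαβ.le
    linarith
  · have h1 : (1 + s) ^ 2 ≤ (1 + 15 * s) * (1 - 4 * s - s ^ 2) := by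
      nlinarith [mul_nonneg hs0.le (sub_nonneg.2 hs1), mul_nonneg (sq_nonneg s) (sub_nonneg.2 hs1)]
    have h2 : γ * (1 - 4 * s - s ^ 2) ≤ ((1 + 15 * s) * (α * β)) * (1 - 4 * s - s ^ 2) := by
      have := mul_le_mul_of_nonneg_right h1 hαβ.le
      linarith
    have h3 : 0 < 1 - 4 * s - s ^ 2 := by nlinarith
    have := le_of_mul_le_mul_right h2 h3
    linarith

/-! ### Growth of balls and exponential sums -/

section Growth

variable {S : Type*} {G : SimpleGraph S}

theorem exists_finset_ball_subset (hconn : G.Connected) {d : ℕ}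
    (hd : ∀ s : S, (G.neighborSet s).encard ≤ d) (s : S) (n : ℕ) :
    ∃ F : Finset S, ball G s n ⊆ F ∧ F.card ≤ (d + 1) ^ n := by
  classical
  have hN : ∀ t, ∃ N : Finset S, (N : Set S) = G.neighborSet t ∧ N.card ≤ d := by
    intro t
    have hfin : (G.neighborSet t).Finite :=
      Set.finite_of_encard_le_coe (hd t)
    refine ⟨hfin.toFinset, by simp, ?_⟩
    have := hd t
    rw [hfin.encard_eq_coe_toFinset_card] at this
    exact_mod_cast this
  choose N hN hNc using hN
  induction n with
  | zero =>
    refine ⟨{s}, fun t ht => ?_, by simp⟩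
    have ht' : G.dist s t ≤ 0 := ht
    have := (hconn.dist_eq_zero_iff).1 (Nat.le_zero.1 ht')
    simp [this]
  | succ n ih =>
    obtain ⟨F, hF, hFc⟩ := ih
    refine ⟨F.biUnion fun t => insert t (N t), fun t ht => ?_, ?_⟩
    · have ht' : G.dist s t ≤ n + 1 := ht
      simp only [Finset.coe_biUnion, Finset.coe_insert, Set.mem_iUnion, Set.mem_insert_iff, hN]
      by_cases h : G.dist s t ≤ n
      · exact ⟨t, hF h, Or.inl rfl⟩
      · obtain ⟨p, hp⟩ := hconn.exists_walk_length_eq_dist t s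
        cases p with
        | nil => simp at h
        | @cons _ t' _ hadj q =>
          refine ⟨t', hF ?_, Or.inr hadj.symm⟩
          have h1 := SimpleGraph.dist_le q
          rw [SimpleGraph.Walk.length_cons, G.dist_comm] at hp
          change G.dist s t' ≤ n
          rw [G.dist_comm]
          omega
    · refine (Finset.card_biUnion_le_card_mul _ _ (d + 1) fun t _ => ?_).trans ?_
      · exact (Finset.card_insert_le _ _).trans (by simpa using hNc t)
      · rw [pow_succ]
        exact Nat.mul_le_mul_right _ hFc

theorem HasBoundedDegree.finite_ball (hconn : G.Connected) (hdeg : HasBoundedDegree G) (s : S)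
    (n : ℕ) : (ball G s n).Finite := by
  obtain ⟨d, hd⟩ := hdeg
  obtain ⟨F, hF, -⟩ := exists_finset_ball_subset hconn hd s n
  exact F.finite_toSet.subset hF

/-- Bounded degree makes the set of admissible growth exponents non-empty, so that `growthRate` is
a genuine infimum. -/
theorem HasBoundedDegree.exists_hasExpGrowthBound (hconn : G.Connected)
    (hdeg : HasBoundedDegree G) : ∃ θ : ℝ, 0 ≤ θ ∧ HasExpGrowthBound G θ := by
  have hfin := hdeg.finite_ball hconn
  obtain ⟨d, hd⟩ := hdeg
  refine ⟨Real.log (d + 1), Real.log_nonneg (by simp), 1, fun s n => ⟨hfin s n, ?_⟩⟩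
  obtain ⟨F, hF, hFc⟩ := exists_finset_ball_subset hconn hd s n
  have h1 : (ball G s n).ncard ≤ (d + 1) ^ n := by
    refine (Set.ncard_le_ncard hF F.finite_toSet).trans ?_
    rwa [Set.ncard_coe_finset]
  rw [one_mul, mul_comm, Real.exp_nat_mul, Real.exp_log (by positivity)]
  exact_mod_cast h1

theorem growthRate_nonneg (G : SimpleGraph S) : 0 ≤ growthRate G :=
  Real.sInf_nonneg fun _ h => h.1

/-- Above the growth rate, the exponential sums over the whole graph are bounded uniformly in the
centre. -/
theorem exists_tsum_exp_dist_le (hconn : G.Connected) (hdeg : HasBoundedDegree G) {a : ℝ}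
    (ha : growthRate G < a) :
    ∃ Z : ℝ≥0, ∀ s : S, ∑' t : S, ENNReal.ofReal (Real.exp (-a * G.dist t s)) ≤ Z := by
  obtain ⟨θ, ⟨-, K, hK⟩, hθ⟩ :=
    exists_lt_of_csInf_lt (hdeg.exists_hasExpGrowthBound hconn) ha
  have hsum : Summable fun n : ℕ => K * Real.exp ((θ - a) * n) := by
    refine Summable.mul_left K ?_
    have := Real.summable_exp_nat_mul_iff.2 (sub_neg.2 hθ)
    simpa only [mul_comm] using this
  refine ⟨(∑' n : ℕ, ENNReal.ofReal (K * Real.exp ((θ - a) * n))).toNNReal, fun s => ?_⟩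
  rw [ENNReal.coe_toNNReal hsum.tsum_ofReal_ne_top]
  calc ∑' t : S, ENNReal.ofReal (Real.exp (-a * G.dist t s))
      ≤ ∑' t : S, ∑' n : ℕ,
          (ball G s n).indicator (fun _ => ENNReal.ofReal (Real.exp (-a * n))) t := by
        refine ENNReal.tsum_le_tsum fun t => le_trans ?_ (ENNReal.le_tsum (G.dist t s))
        rw [Set.indicator_of_mem]
        exact (G.dist_comm).le
    _ = ∑' n : ℕ, ∑' t : S,
          (ball G s n).indicator (fun _ => ENNReal.ofReal (Real.exp (-a * n))) t :=
        ENNReal.tsum_comm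
    _ ≤ ∑' n : ℕ, ENNReal.ofReal (K * Real.exp ((θ - a) * n)) := by
        refine ENNReal.tsum_le_tsum fun n => ?_
        rw [← tsum_subtype, ENNReal.tsum_set_const, ← (hK s n).1.cast_ncard_eq, sub_mul,
          sub_eq_add_neg, Real.exp_add, ← mul_assoc, ENNReal.ofReal_mul' (Real.exp_pos _).le, neg_mul]
        gcongr
        rw [ENat.toENNReal_coe, ← ENNReal.ofReal_natCast]
        exact ENNReal.ofReal_le_ofReal (hK s n).2

theorem tsum_exp_dist_le_of_le {a lam x : ℝ} (hlam : a ≤ lam) {Z : ℝ≥0} {s : S}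
    (hZ : ∑' t : S, ENNReal.ofReal (Real.exp (-a * G.dist t s)) ≤ Z) {P : Set S}
    (hP : ∀ t ∈ P, x ≤ G.dist t s) :
    ∑' t : P, ENNReal.ofReal (Real.exp (-lam * G.dist (t : S) s)) ≤
      ENNReal.ofReal (Real.exp (-(lam - a) * x)) * Z := by
  calc ∑' t : P, ENNReal.ofReal (Real.exp (-lam * G.dist (t : S) s))
      ≤ ∑' t : P, ENNReal.ofReal (Real.exp (-(lam - a) * x)) *
          ENNReal.ofReal (Real.exp (-a * G.dist (t : S) s)) := by
        refine ENNReal.tsum_le_tsum fun t => ?_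
        rw [← ENNReal.ofReal_mul (Real.exp_pos _).le, ← Real.exp_add]
        refine ENNReal.ofReal_le_ofReal (Real.exp_le_exp.2 ?_)
        nlinarith [mul_le_mul_of_nonneg_left (hP t t.2) (sub_nonneg.2 hlam)]
    _ ≤ _ := by
        rw [ENNReal.tsum_mul_left]
        gcongr
        exact (ENNReal.tsum_comp_le_tsum_of_injective Subtype.val_injective _).trans hZ

/-- If every site of `P` is about as close to `V` as to `u`, then its distance to `u` is about half
of the distance from `u` to some site of `V`; hence the sum over `P` is bounded by a sum over `V` at
half of the excess rate `lam - a`. -/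
theorem tsum_exp_dist_le_tsum_of_near (hconn : G.Connected) {a lam : ℝ} (hlam : a ≤ lam) {Z : ℝ≥0}
    {u : S} (hZ : ∑' t : S, ENNReal.ofReal (Real.exp (-a * G.dist t u)) ≤ Z) {k : ℕ}
    {P V : Set S} (hP : ∀ t ∈ P, ∃ v ∈ V, G.dist t v ≤ G.dist t u + 2 * k) :
    ∑' t : P, ENNReal.ofReal (Real.exp (-lam * G.dist (t : S) u)) ≤
      ENNReal.ofReal (Real.exp ((lam - a) * k)) * Z *
        ∑' v : V, ENNReal.ofReal (Real.exp (-((lam - a) / 2) * G.dist u (v : S))) := by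
  have hsub : P ⊆ ⋃ v : V, {t | G.dist t (v : S) ≤ G.dist t u + 2 * k} := by
    intro t ht
    obtain ⟨v, hv, h⟩ := hP t ht
    exact Set.mem_iUnion.2 ⟨⟨v, hv⟩, h⟩
  refine (ENNReal.tsum_mono_subtype
    (fun t => ENNReal.ofReal (Real.exp (-lam * G.dist t u))) hsub).trans ?_
  refine (ENNReal.tsum_iUnion_le_tsum
    (fun t => ENNReal.ofReal (Real.exp (-lam * G.dist t u))) _).trans ?_
  rw [← ENNReal.tsum_mul_left]
  refine ENNReal.tsum_le_tsum fun v => ?_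
  refine (tsum_exp_dist_le_of_le hlam hZ
    (x := (G.dist u (v : S) : ℝ) / 2 - k) fun t ht => ?_).trans_eq ?_
  · have h1 : G.dist t (v : S) ≤ G.dist t u + 2 * k := ht
    have h2 := hconn.dist_triangle (u := u) (v := t) (w := v)
    rw [G.dist_comm (u := u) (v := t)] at h2
    have h3 : G.dist u (v : S) ≤ 2 * G.dist t u + 2 * k := by omega
    have h4 : (G.dist u (v : S) : ℝ) ≤ 2 * G.dist t u + 2 * k := by exact_mod_cast h3
    linarith
  · rw [mul_right_comm, ← ENNReal.ofReal_mul (Real.exp_pos _).le, ← Real.exp_add]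
    congr 4
    ring

theorem expSum_comm (lam : ℝ) (U V : Set S) : expSum G lam U V = expSum G lam V U := by
  unfold expSum
  rw [ENNReal.tsum_comm]
  simp only [G.dist_comm]

theorem expSum_union_right_le (lam : ℝ) (D U V : Set S) :
    expSum G lam D (U ∪ V) ≤ expSum G lam D U + expSum G lam D V := by
  unfold expSum
  rw [← ENNReal.tsum_add]
  exact ENNReal.tsum_le_tsum fun t => ENNReal.tsum_union_le
    (fun s => ENNReal.ofReal (Real.exp (-lam * G.dist (t : S) s))) U V

theorem expSum_mono_left (lam : ℝ) {U U' : Set S} (h : U' ⊆ U) (V : Set S) :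
    expSum G lam U' V ≤ expSum G lam U V :=
  ENNReal.tsum_mono_subtype
    (fun t => ∑' s : V, ENNReal.ofReal (Real.exp (-lam * G.dist t (s : S)))) h

theorem expSum_two_mul_le_sq (m : ℝ) (U V : Set S) :
    expSum G (2 * m) U V ≤ expSum G m U V ^ 2 := by
  have hle (t : U) (s : V) : ENNReal.ofReal (Real.exp (-(2 * m) * G.dist (t : S) (s : S))) ≤
      expSum G m U V * ENNReal.ofReal (Real.exp (-m * G.dist (t : S) (s : S))) := by
    have h1 : ENNReal.ofReal (Real.exp (-(2 * m) * G.dist (t : S) (s : S))) =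
        ENNReal.ofReal (Real.exp (-m * G.dist (t : S) (s : S))) *
          ENNReal.ofReal (Real.exp (-m * G.dist (t : S) (s : S))) := by
      rw [← ENNReal.ofReal_mul (Real.exp_pos _).le, ← Real.exp_add]
      congr 2
      ring
    rw [h1]
    gcongr
    exact (ENNReal.le_tsum (f := fun s : V =>
      ENNReal.ofReal (Real.exp (-m * G.dist (t : S) (s : S)))) s).trans
      (ENNReal.le_tsum (f := fun t : U => ∑' s : V,
        ENNReal.ofReal (Real.exp (-m * G.dist (t : S) (s : S)))) t)
  rw [sq]
  conv_rhs => rhs; unfold expSum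
  rw [← ENNReal.tsum_mul_left]
  refine ENNReal.tsum_le_tsum fun t => ?_
  rw [← ENNReal.tsum_mul_left]
  exact ENNReal.tsum_le_tsum fun s => hle t s

end Growth

/-! ### Truncated Voronoi cells -/

section Separation

variable {S : Type*} {G : SimpleGraph S}

/-- The sites within distance `R` of `U` that are strictly closer to `U` than to `V`: the Voronoi
cell of `U`, truncated at distance `R`. The truncation keeps it finite. -/
def voronoiCell (G : SimpleGraph S) (U V : Set S) (R : ℕ) : Set S :=
  {t | ∃ u ∈ U, G.dist t u ≤ R ∧ ∀ v ∈ V, G.dist t u < G.dist t v}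

theorem subset_voronoiCell (hconn : G.Connected) {U V : Set S} (hUV : Disjoint U V) (R : ℕ) :
    U ⊆ voronoiCell G U V R := by
  intro u hu
  refine ⟨u, hu, by simp, fun v hv => ?_⟩
  rw [SimpleGraph.dist_self]
  exact hconn.pos_dist_of_ne (hUV.ne_of_mem hu hv)

theorem subset_compl_voronoiCell (U V : Set S) (R : ℕ) : V ⊆ (voronoiCell G U V R)ᶜ := by
  rintro v hv ⟨u, -, -, h⟩
  simpa using h v hv

theorem finite_voronoiCell (hconn : G.Connected) (hdeg : HasBoundedDegree G) {U : Set S}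
    (hU : U.Finite) (V : Set S) (R : ℕ) : (voronoiCell G U V R).Finite := by
  refine (hU.biUnion fun u _ => hdeg.finite_ball hconn u R).subset ?_
  rintro t ⟨u, hu, h, -⟩
  refine Set.mem_biUnion hu ?_
  rw [G.dist_comm] at h
  exact h

theorem finite_kBoundary (hconn : G.Connected) (hdeg : HasBoundedDegree G) (k : ℕ) {Λ : Set S}
    (hΛ : Λ.Finite) : (kBoundary G k Λ).Finite := by
  refine (hΛ.biUnion fun u _ => hdeg.finite_ball hconn u k).subset ?_
  rintro t ⟨-, u, hu, h⟩
  refine Set.mem_biUnion hu ?_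
  rw [G.dist_comm] at h
  exact h

/-- A site of the boundary of the truncated Voronoi cell has distance about half of `d(u, v)` from
the points of `U` and of `V`, or lies beyond the truncation radius. Hence the interaction of
this boundary with `U ∪ V` is controlled by the interaction between `U` and `V` at half of the rate,
up to a truncation error. -/
theorem expSum_kBoundary_voronoiCell_le (hconn : G.Connected) {a lam : ℝ} (hlam : a ≤ lam)
    {Z : ℝ≥0} (hZ : ∀ s, ∑' t : S, ENNReal.ofReal (Real.exp (-a * G.dist t s)) ≤ Z) (k R : ℕ)
    (U V : Set S) :
    expSum G lam (kBoundary G k (voronoiCell G U V R)) (U ∪ V) ≤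
      U.encard * (ENNReal.ofReal (Real.exp (-(lam - a) * R)) * Z) +
        2 * (ENNReal.ofReal (Real.exp ((lam - a) * k)) * Z * expSum G ((lam - a) / 2) U V) := by
  set D := kBoundary G k (voronoiCell G U V R) with hD
  have hu : ∀ t ∈ D, ∀ u ∈ U, R ≤ G.dist t u ∨ ∃ v ∈ V, G.dist t v ≤ G.dist t u + 2 * k := by
    rintro t ⟨ht, -⟩ u hu
    by_contra! h
    exact ht ⟨u, hu, h.1.le, fun v hv => by have := h.2 v hv; omega⟩
  have hv : ∀ t ∈ D, ∀ v ∈ V, ∃ u ∈ U, G.dist t u ≤ G.dist t v + 2 * k := by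
    rintro t ⟨-, t', ⟨u, hu, -, h⟩, htt⟩ v hv
    refine ⟨u, hu, ?_⟩
    have h1 := h v hv
    have h2 := hconn.dist_triangle (u := t) (v := t') (w := u)
    have h3 := hconn.dist_triangle (u := t') (v := t) (w := v)
    rw [G.dist_comm (u := t') (v := t)] at h3
    omega
  refine (expSum_union_right_le lam D U V).trans ?_
  have hDU : expSum G lam D U ≤ U.encard * (ENNReal.ofReal (Real.exp (-(lam - a) * R)) * Z) +
      ENNReal.ofReal (Real.exp ((lam - a) * k)) * Z * expSum G ((lam - a) / 2) U V := by
    rw [expSum_comm, expSum, expSum, ← ENNReal.tsum_set_const, ← ENNReal.tsum_mul_left,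
      ← ENNReal.tsum_add]
    refine ENNReal.tsum_le_tsum fun u => ?_
    have hsub : D ⊆ {t | R ≤ G.dist t (u : S)} ∪
        {t | ∃ v ∈ V, G.dist t v ≤ G.dist t (u : S) + 2 * k} := fun t ht => hu t ht u u.2
    simp only [G.dist_comm (u := (u : S))]
    refine (ENNReal.tsum_mono_subtype
      (fun t => ENNReal.ofReal (Real.exp (-lam * G.dist t (u : S)))) hsub).trans ?_
    refine (ENNReal.tsum_union_le
      (fun t => ENNReal.ofReal (Real.exp (-lam * G.dist t (u : S)))) _ _).trans ?_
    refine add_le_add (tsum_exp_dist_le_of_le hlam (hZ u) fun t ht => ?_) ?_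
    · exact_mod_cast ht
    · have := tsum_exp_dist_le_tsum_of_near hconn hlam (hZ u) (k := k) (V := V)
        (P := {t | ∃ v ∈ V, G.dist t v ≤ G.dist t (u : S) + 2 * k}) fun t ht => ht
      simpa only [G.dist_comm (u := (u : S))] using this
  have hDV : expSum G lam D V ≤
      ENNReal.ofReal (Real.exp ((lam - a) * k)) * Z * expSum G ((lam - a) / 2) U V := by
    rw [expSum_comm, expSum_comm _ U, expSum, expSum, ← ENNReal.tsum_mul_left]
    refine ENNReal.tsum_le_tsum fun v => ?_
    have := tsum_exp_dist_le_tsum_of_near hconn hlam (hZ v) (k := k) (V := U)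
        (P := D) fun t ht => hv t ht v v.2
    simpa only [G.dist_comm (u := (v : S))] using this
  calc _ ≤ _ := add_le_add hDU hDV
    _ = _ := by rw [add_assoc, two_mul]

end Separation

/-! ### Approximation by finitely many coordinates, and dependence coefficients -/

section Events

variable {S E : Type*} [MeasurableSpace E]

theorem sum_measureReal_inter_preimage_singleton {Ω W : Type*} [MeasurableSpace Ω] {μ : Measure Ω}
    [IsFiniteMeasure μ] {r : Ω → W} (hr : ∀ w, MeasurableSet (r ⁻¹' {w})) {A : Set Ω}
    (P : Finset W) : ∑ w ∈ P, μ.real (A ∩ r ⁻¹' {w}) = μ.real (A ∩ r ⁻¹' P) := by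
  have hP : MeasurableSet (r ⁻¹' (P : Set W)) := by
    rw [← Set.biUnion_preimage_singleton]
    exact P.measurableSet_biUnion fun w _ => hr w
  have h := sum_measureReal_preimage_singleton (μ := μ.restrict A) P fun w _ => hr w
  simp_rw [measureReal_restrict_apply (hr _), measureReal_restrict_apply hP] at h
  simpa only [Set.inter_comm] using h

theorem measurableSet_cylinderEvents_preimage_domRestrict [Finite E] [MeasurableSingletonClass E]
    {D : Set S} (hD : D.Finite) (P : Set (D → E)) :
    MeasurableSet[cylinderEvents D] (D.domRestrict (π := fun _ : S => E) ⁻¹' P) := by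
  have := hD.to_subtype
  exact measurable_restrict_cylinderEvents D P.toFinite.measurableSet

/-- The events that depend on finitely many coordinates in `U` approximate every event of `U`. -/
theorem exists_finset_cylinderEvents_symmDiff_lt (μ : Measure (S → E)) [IsFiniteMeasure μ]
    {U : Set S} {A : Set (S → E)} (hA : MeasurableSet[cylinderEvents U] A) {ε : ℝ} (hε : 0 < ε) :
    ∃ (F : Finset S) (A' : Set (S → E)), (F : Set S) ⊆ U ∧
      MeasurableSet[cylinderEvents (F : Set S)] A' ∧ μ.real (symmDiff A A') < ε := by
  classical
  set 𝒜 : Set (Set (S → E)) := {A' | ∃ F : Finset S, (F : Set S) ⊆ U ∧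
    MeasurableSet[cylinderEvents (F : Set S)] A'} with h𝒜
  have halg : IsSetAlgebra 𝒜 := by
    refine ⟨⟨∅, by simp, @MeasurableSet.empty _ (cylinderEvents _)⟩, ?_, ?_⟩
    · rintro s ⟨F, hF, hs⟩
      exact ⟨F, hF, hs.compl⟩
    · rintro s t ⟨F, hF, hs⟩ ⟨F', hF', ht⟩
      refine ⟨F ∪ F', by simp [hF, hF'], ?_⟩
      rw [Finset.coe_union]
      exact (cylinderEvents_mono Set.subset_union_left _ hs).union
        (cylinderEvents_mono Set.subset_union_right _ ht)
  have hgen : cylinderEvents U = MeasurableSpace.generateFrom 𝒜 := by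
    apply le_antisymm
    · refine iSup₂_le fun i hi => ?_
      rintro _ ⟨e, he, rfl⟩
      refine MeasurableSpace.measurableSet_generateFrom ⟨{i}, by simpa using hi, ?_⟩
      exact measurable_cylinderEvent_apply (X := fun _ : S => E) (by simp) he
    · refine MeasurableSpace.generateFrom_le ?_
      rintro s ⟨F, hF, hs⟩
      exact cylinderEvents_mono hF _ hs
  have hle : cylinderEvents (X := fun _ : S => E) U ≤ MeasurableSpace.pi := cylinderEvents_le_pi
  have hdense := @Measure.MeasureDense.of_generateFrom_isSetAlgebra_finite _ (cylinderEvents U)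
    (μ.trim hle) 𝒜 _ halg hgen
  obtain ⟨A', ⟨F, hF, hA'⟩, h⟩ := @Measure.MeasureDense.approx _ (cylinderEvents U) _ _ hdense A hA
    (@measure_ne_top _ (cylinderEvents U) _ _ A) ε hε
  refine ⟨F, A', hF, hA', ?_⟩
  rw [trim_measurableSet_eq hle (hA.symmDiff (cylinderEvents_mono hF _ hA'))] at h
  rw [measureReal_def, ← ENNReal.toReal_ofReal hε.le]
  exact (ENNReal.toReal_lt_toReal (measure_ne_top _ _) ENNReal.ofReal_ne_top).2 h

/-- A bound on the dependence between a fixed event and all events of finitely many coordinates in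
`U` extends to all events of `U`. -/
theorem abs_sub_le_of_forall_finset (μ : Measure (S → E)) [IsProbabilityMeasure μ] {U : Set S}
    {B : Set (S → E)} (hB : MeasurableSet B) {c : ℝ} (hc : 0 ≤ c)
    (h : ∀ F : Finset S, (F : Set S) ⊆ U → ∀ A, MeasurableSet[cylinderEvents (F : Set S)] A →
      |μ.real (A ∩ B) - μ.real A * μ.real B| ≤ c * (μ.real A * μ.real B))
    {A : Set (S → E)} (hA : MeasurableSet[cylinderEvents U] A) :
    |μ.real (A ∩ B) - μ.real A * μ.real B| ≤ c * (μ.real A * μ.real B) := by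
  refine le_of_forall_pos_le_add fun ε hε => ?_
  obtain ⟨F, A', hF, hA', hlt⟩ := exists_finset_cylinderEvents_symmDiff_lt μ hA
    (ε := ε / (2 + c)) (by positivity)
  have hA0 : MeasurableSet A := cylinderEvents_le_pi _ hA
  have hA0' : MeasurableSet A' := cylinderEvents_le_pi _ hA'
  have h1 : |μ.real A - μ.real A'| ≤ μ.real (symmDiff A A') :=
    abs_measureReal_sub_le_measureReal_symmDiff hA0.nullMeasurableSet hA0'.nullMeasurableSet
  have h2 : |μ.real (A ∩ B) - μ.real (A' ∩ B)| ≤ μ.real (symmDiff A A') := by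
    refine (abs_measureReal_sub_le_measureReal_symmDiff (hA0.inter hB).nullMeasurableSet
      (hA0'.inter hB).nullMeasurableSet).trans (measureReal_mono ?_)
    rw [← Set.inter_symmDiff_distrib_right]
    exact Set.inter_subset_left
  have h3 := h F hF A' hA'
  have hB0 : 0 ≤ μ.real B := measureReal_nonneg
  have hB1 : μ.real B ≤ 1 := measureReal_le_one
  set δ := μ.real (symmDiff A A') with hδ
  have hδ0 : 0 ≤ δ := measureReal_nonneg
  have h4 : |μ.real A * μ.real B - μ.real A' * μ.real B| ≤ δ := by
    rw [← sub_mul, abs_mul, abs_of_nonneg hB0]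
    nlinarith [abs_nonneg (μ.real A - μ.real A')]
  have h5 : (2 + c) * δ ≤ ε := by
    rw [lt_div_iff₀ (by positivity)] at hlt
    linarith
  rw [abs_le] at h2 h3 h4 ⊢
  have h6 : c * (μ.real A' * μ.real B) ≤ c * (μ.real A * μ.real B + δ) :=
    mul_le_mul_of_nonneg_left (by linarith) hc
  constructor <;> nlinarith

theorem abs_sub_le_of_mixingCoeff_phiDep_le {μ : Measure (S → E)} [IsProbabilityMeasure μ]
    {U V : Set S} {ε : ℝ} (hε : 0 ≤ ε)
    (h : mixingCoeff μ (phiDep μ) U V ≤ ENNReal.ofReal ε) {A B : Set (S → E)}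
    (hA : MeasurableSet[cylinderEvents U] A) (hB : MeasurableSet[cylinderEvents V] B) :
    |μ.real (B ∩ A) - μ.real B * μ.real A| ≤ ε * μ.real B := by
  rcases eq_or_ne (μ A) 0 with hA0 | hA0
  · rw [measureReal_def, measureReal_def (s := A), measure_mono_null Set.inter_subset_right hA0,
      hA0]
    simpa using mul_nonneg hε measureReal_nonneg
  rcases eq_or_ne (μ B) 0 with hB0 | hB0
  · rw [measureReal_def, measureReal_def (s := B), measure_mono_null Set.inter_subset_left hB0,
      hB0]
    simp
  have h1 : phiDep μ A B ≤ ε := by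
    rw [← ENNReal.ofReal_le_ofReal_iff hε]
    refine le_trans ?_ h
    unfold mixingCoeff
    exact le_iSup₂_of_le A B (le_iSup₂_of_le hA hB
      (le_iSup₂_of_le (pos_iff_ne_zero.2 hA0) (pos_iff_ne_zero.2 hB0) le_rfl))
  have hB' : MeasurableSet B := cylinderEvents_le_pi _ hB
  have hBpos : 0 < μ.real B := ENNReal.toReal_pos hB0 (measure_ne_top _ _)
  rw [phiDep, measureReal_def, cond_apply hB', ENNReal.toReal_mul, ENNReal.toReal_inv,
    ← measureReal_def, ← measureReal_def] at h1
  have h2 : μ.real (B ∩ A) - μ.real B * μ.real A =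
      ((μ.real B)⁻¹ * μ.real (B ∩ A) - μ.real A) * μ.real B := by
    field_simp
  rw [h2, abs_mul, abs_of_pos hBpos]
  exact mul_le_mul_of_nonneg_right h1 hBpos.le

end Events

/-! ### Separation by the boundary of a finite set -/

section Markov

variable {S E : Type*} [MeasurableSpace E] [Countable S] [Finite E] [MeasurableSingletonClass E]

/-- Conditionally on a configuration on the `k`-boundary of `Λ`, the events inside and outside of
`Λ` are independent. -/
theorem IsMarkovian.mul_eq_mul {G : SimpleGraph S} {k : ℕ} {μ : Measure (S → E)}
    [IsProbabilityMeasure μ] (hk : IsMarkovian G k μ) (Λ : Finset S)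
    (hD : (kBoundary G k (Λ : Set S)).Finite) {A B : Set (S → E)}
    (hA : MeasurableSet[cylinderEvents (Λ : Set S)] A)
    (hB : MeasurableSet[cylinderEvents (Λ : Set S)ᶜ] B) (w : kBoundary G k (Λ : Set S) → E) :
    μ.real (A ∩ B ∩ (kBoundary G k (Λ : Set S)).domRestrict ⁻¹' {w}) *
        μ.real ((kBoundary G k (Λ : Set S)).domRestrict ⁻¹' {w}) =
      μ.real (A ∩ (kBoundary G k (Λ : Set S)).domRestrict ⁻¹' {w}) *
        μ.real (B ∩ (kBoundary G k (Λ : Set S)).domRestrict ⁻¹' {w}) := by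
  set W : Set (S → E) := (kBoundary G k (Λ : Set S)).domRestrict ⁻¹' {w} with hW
  have hle : cylinderEvents (X := fun _ : S => E) (Λ : Set S)ᶜ ≤ MeasurableSpace.pi :=
    cylinderEvents_le_pi
  have hWm : MeasurableSet[cylinderEvents (Λ : Set S)ᶜ] W :=
    cylinderEvents_mono (fun s hs => hs.1) _
      (measurableSet_cylinderEvents_preimage_domRestrict hD {w})
  rcases eq_or_ne (μ W) 0 with h0 | h0
  · rw [measureReal_def, measureReal_def (s := A ∩ W),
      measure_mono_null Set.inter_subset_right h0, measure_mono_null Set.inter_subset_right h0]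
    simp
  -- The conditional probability of `A` is almost surely constant on `W`.
  obtain ⟨c, hc⟩ : ∃ c : ℝ, ∀ᵐ τ ∂μ, τ ∈ W →
      (μ⟦A | cylinderEvents (Λ : Set S)ᶜ⟧) τ = c := by
    obtain ⟨ω, hωW, hω⟩ : ∃ ω ∈ W, ∀ᵐ τ ∂μ,
        (∀ s ∈ kBoundary G k (Λ : Set S), ω s = τ s) → localCond μ Λ ω = localCond μ Λ τ := by
      by_contra hcon
      simp only [not_exists, not_and] at hcon
      exact h0 (measure_mono_null (fun ω hω => hcon ω hω) (ae_iff.1 (hk Λ)))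
    refine ⟨(localCond μ Λ ω A).toReal, ?_⟩
    filter_upwards [hω, localCond_ae_eq μ Λ hA] with τ hτ hτA hτW
    rw [← hτA, hτ]
    intro s hs
    have h1 : (kBoundary G k (Λ : Set S)).domRestrict ω = w := hωW
    have h2 : (kBoundary G k (Λ : Set S)).domRestrict τ = w := hτW
    exact congrFun (h1.trans h2.symm) ⟨s, hs⟩
  have hA' : MeasurableSet A := cylinderEvents_le_pi _ hA
  have key : ∀ C, MeasurableSet[cylinderEvents (Λ : Set S)ᶜ] C → C ⊆ W →
      μ.real (A ∩ C) = c * μ.real C := by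
    intro C hC hCW
    have h1 : ∫ τ in C, (μ⟦A | cylinderEvents (Λ : Set S)ᶜ⟧) τ ∂μ = μ.real (A ∩ C) := by
      rw [setIntegral_condExp hle ((integrable_const (1 : ℝ)).indicator hA') hC,
        setIntegral_indicator hA']
      simp [Set.inter_comm]
    have h2 : ∫ τ in C, (μ⟦A | cylinderEvents (Λ : Set S)ᶜ⟧) τ ∂μ = ∫ τ in C, c ∂μ := by
      refine setIntegral_congr_ae (hle _ hC) ?_
      filter_upwards [hc] with τ hτ hτC using hτ (hCW hτC)
    rw [← h1, h2]
    simp [mul_comm]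
  rw [Set.inter_assoc, key (B ∩ W) (hB.inter hWm) Set.inter_subset_right,
    key W hWm subset_rfl]
  ring

/-- If `Λ` separates `U` from `V`, and the events of the `k`-boundary of `Λ` are almost independent
of the events of `U ∪ V` in the sense of the coefficient `φ`, then the events of `U` and of `V`
are almost independent in the sense of the coefficient `ψ`, with the square root of the error. -/
theorem IsMarkovian.abs_sub_le_of_separation {G : SimpleGraph S} {k : ℕ} {μ : Measure (S → E)}
    [IsProbabilityMeasure μ] (hk : IsMarkovian G k μ) (Λ : Finset S)
    (hD : (kBoundary G k (Λ : Set S)).Finite) {U V : Set S} (hU : U ⊆ Λ) (hV : V ⊆ (Λ : Set S)ᶜ)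
    {s : ℝ} (hs0 : 0 < s) (hs1 : s ≤ 1 / 10)
    (hφ : mixingCoeff μ (phiDep μ) (kBoundary G k (Λ : Set S)) (U ∪ V) ≤ ENNReal.ofReal (s ^ 2))
    {A B : Set (S → E)} (hA : MeasurableSet[cylinderEvents U] A)
    (hB : MeasurableSet[cylinderEvents V] B) (hA0 : 0 < μ A) (hB0 : 0 < μ B) :
    |μ.real (A ∩ B) - μ.real A * μ.real B| ≤ 15 * s * (μ.real A * μ.real B) := by
  classical
  set D := kBoundary G k (Λ : Set S) with hDdef
  have := hD.to_subtype
  have : Fintype (D → E) := Fintype.ofFinite _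
  have hm : ∀ w, MeasurableSet (D.domRestrict (π := fun _ : S => E) ⁻¹' {w}) := fun w =>
    cylinderEvents_le_pi _ (measurableSet_cylinderEvents_preimage_domRestrict hD {w})
  have hAUV : MeasurableSet[cylinderEvents (U ∪ V)] A :=
    cylinderEvents_mono Set.subset_union_left _ hA
  have hBUV : MeasurableSet[cylinderEvents (U ∪ V)] B :=
    cylinderEvents_mono Set.subset_union_right _ hB
  have hdep : ∀ C, MeasurableSet[cylinderEvents (U ∪ V)] C → ∀ P : Finset (D → E),
      |∑ w ∈ P, μ.real (C ∩ D.domRestrict ⁻¹' {w}) -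
        μ.real C * ∑ w ∈ P, μ.real (D.domRestrict ⁻¹' {w})| ≤ s ^ 2 * μ.real C := by
    intro C hC P
    have h := abs_sub_le_of_mixingCoeff_phiDep_le (sq_nonneg s) hφ
      (measurableSet_cylinderEvents_preimage_domRestrict hD P) hC
    rwa [sum_measureReal_inter_preimage_singleton hm, sum_measureReal_preimage_singleton P fun w _ => hm w]
  have htot : ∀ C : Set (S → E), ∑ w, μ.real (C ∩ D.domRestrict ⁻¹' {w}) = μ.real C := by
    intro C
    rw [sum_measureReal_inter_preimage_singleton hm]
    simp
  refine abs_sub_mul_le_of_weights (W := D → E)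
    (p := fun w => μ.real (D.domRestrict ⁻¹' {w}))
    (a := fun w => μ.real (A ∩ D.domRestrict ⁻¹' {w}))
    (b := fun w => μ.real (B ∩ D.domRestrict ⁻¹' {w}))
    (c := fun w => μ.real (A ∩ B ∩ D.domRestrict ⁻¹' {w})) hs0 hs1
    (ENNReal.toReal_pos hA0.ne' (measure_ne_top _ _))
    (ENNReal.toReal_pos hB0.ne' (measure_ne_top _ _)) (fun _ => measureReal_nonneg)
    (fun _ => measureReal_nonneg) (fun _ => measureReal_nonneg)
    (fun _ => measureReal_mono Set.inter_subset_right) ?_ (htot _) (fun w => ?_)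
    (hdep A hAUV) (hdep B hBUV) (hdep _ (hAUV.inter hBUV))
  · simpa using htot Set.univ
  · exact hk.mul_eq_mul Λ hD (cylinderEvents_mono hU _ hA) (cylinderEvents_mono hV _ hB) w

end Markov

/-! ### From `φ`-mixing to `ψ`-mixing for a finite set of sites -/

section Mixing

open Filter Topology

variable {S E : Type*} {G : SimpleGraph S}

theorem one_le_expSum_of_not_disjoint {lam : ℝ} {U V : Set S} (h : ¬Disjoint U V) :
    1 ≤ expSum G lam U V := by
  obtain ⟨x, hxU, hxV⟩ := Set.not_disjoint_iff.1 h
  calc (1 : ℝ≥0∞) = ENNReal.ofReal (Real.exp (-lam * G.dist x x)) := by simp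
    _ ≤ ∑' s : V, ENNReal.ofReal (Real.exp (-lam * G.dist x (s : S))) :=
        ENNReal.le_tsum (f := fun s : V =>
          ENNReal.ofReal (Real.exp (-lam * G.dist x (s : S)))) ⟨x, hxV⟩
    _ ≤ _ := ENNReal.le_tsum (f := fun t : U => ∑' s : V,
          ENNReal.ofReal (Real.exp (-lam * G.dist (t : S) (s : S)))) ⟨x, hxU⟩

variable [MeasurableSpace E] [Countable S] [Finite E] [MeasurableSingletonClass E]

/-- The `ψ`-type estimate for finite `U`: the separating set is the boundary of the truncated Voronoi
cell of `U`, with the truncation radius so large that the truncation error is absorbed by the strict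
inequality `hs`. The set `V` may be infinite. -/
theorem IsMarkovian.abs_sub_le_of_expSum_lt (hconn : G.Connected) (hdeg : HasBoundedDegree G)
    {k : ℕ} {μ : Measure (S → E)} [IsProbabilityMeasure μ] (hk : IsMarkovian G k μ) {lam : ℝ}
    {C : ℝ≥0} (hφ : ∀ U V : Set S, C * expSum G lam U V < 1 →
      mixingCoeff μ (phiDep μ) U V ≤ C * expSum G lam U V)
    {a : ℝ} (hlam : a < lam) {Z : ℝ≥0}
    (hZ : ∀ s, ∑' t : S, ENNReal.ofReal (Real.exp (-a * G.dist t s)) ≤ Z)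
    {U V : Set S} (hU : U.Finite) (hUV : Disjoint U V) {s : ℝ} (hs0 : 0 < s) (hs1 : s ≤ 1 / 10)
    (hs : C * (2 * (ENNReal.ofReal (Real.exp ((lam - a) * k)) * Z *
      expSum G ((lam - a) / 2) U V)) < ENNReal.ofReal (s ^ 2))
    {A B : Set (S → E)} (hA : MeasurableSet[cylinderEvents U] A)
    (hB : MeasurableSet[cylinderEvents V] B) (hA0 : 0 < μ A) (hB0 : 0 < μ B) :
    |μ.real (A ∩ B) - μ.real A * μ.real B| ≤ 15 * s * (μ.real A * μ.real B) := by
  set X := 2 * (ENNReal.ofReal (Real.exp ((lam - a) * k)) * Z *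
      expSum G ((lam - a) / 2) U V) with hX
  obtain ⟨R, hR⟩ : ∃ R : ℕ,
      (C : ℝ≥0∞) * (U.encard * (ENNReal.ofReal (Real.exp (-(lam - a) * R)) * Z) + X) <
        ENNReal.ofReal (s ^ 2) := by
    have h1 : Tendsto (fun R : ℕ => ENNReal.ofReal (Real.exp (-(lam - a) * R))) atTop (𝓝 0) := by
      rw [← ENNReal.ofReal_zero]
      refine ENNReal.tendsto_ofReal (Real.tendsto_exp_atBot.comp ?_)
      exact tendsto_natCast_atTop_atTop.const_mul_atTop_of_neg (by linarith)
    have hcard : ((U.encard : ℕ∞) : ℝ≥0∞) ≠ ⊤ := by simpa using hU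
    have h2 := ENNReal.Tendsto.const_mul (a := (U.encard : ℝ≥0∞))
      (ENNReal.Tendsto.mul_const (b := (Z : ℝ≥0∞)) h1 (Or.inr ENNReal.coe_ne_top)) (Or.inr hcard)
    have h3 := ENNReal.Tendsto.const_mul (a := (C : ℝ≥0∞)) (h2.add_const X)
      (Or.inr ENNReal.coe_ne_top)
    rw [zero_mul, mul_zero, zero_add] at h3
    exact (h3.eventually_lt_const hs).exists
  have hfin := finite_voronoiCell hconn hdeg hU V R
  have hbd := finite_kBoundary hconn hdeg k hfin
  have hlt : C * expSum G lam (kBoundary G k (voronoiCell G U V R)) (U ∪ V) <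
      ENNReal.ofReal (s ^ 2) := by
    refine lt_of_le_of_lt ?_ hR
    gcongr
    exact expSum_kBoundary_voronoiCell_le hconn hlam.le hZ k R U V
  have hlt1 : ENNReal.ofReal (s ^ 2) ≤ 1 := by
    rw [← ENNReal.ofReal_one]
    exact ENNReal.ofReal_le_ofReal (by nlinarith)
  have hmix := (hφ _ _ (hlt.trans_le hlt1)).trans hlt.le
  refine hk.abs_sub_le_of_separation hfin.toFinset ?_ ?_ ?_ hs0 hs1 ?_ hA hB hA0 hB0
  · simpa using hbd
  · simpa using subset_voronoiCell hconn hUV R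
  · simpa using subset_compl_voronoiCell U V R
  · simpa using hmix

end Mixing

end RandomField

theorem theorem3p4 {S : Type*} [Countable S] (G : SimpleGraph S) (hconn : G.Connected)
    (hdeg : RandomField.HasBoundedDegree G)
    {E : Type*} [Finite E] [MeasurableSpace E] [MeasurableSingletonClass E]
    (μ : Measure (S → E)) [IsProbabilityMeasure μ] (hnd : RandomField.IsNonDegenerate μ)
    (lam : ℝ) (hlam : 3 * RandomField.growthRate G < lam)
    (k : ℕ) (hk : RandomField.IsMarkovian G k μ)
    (hφ : RandomField.IsPhiMixing G μ lam) :
    RandomField.IsPsiMixing G μ ((lam - 3 * RandomField.growthRate G) / 9) := by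
  open RandomField in
  obtain ⟨C, -, hφ⟩ := hφ
  set r := (lam - 3 * growthRate G) / 9 with hr
  have hr0 : 0 < r := by rw [hr]; linarith
  -- The rate `lam` is spent as `(lam - 4 r) + 4 r`: the first part, which exceeds the growth rate,
  -- makes the exponential sums converge; of the second, one half is lost because the separating set
  -- lies halfway between `U` and `V`, and another half because of the square root of the error.
  obtain ⟨Z, hZ⟩ := exists_tsum_exp_dist_le hconn hdeg (a := lam - 4 * r)
    (by have := growthRate_nonneg G; rw [hr]; linarith)
  have ha : lam - 4 * r < lam := by linarith
  have hsub : lam - (lam - 4 * r) = 4 * r := by ring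
  set M : ℝ≥0 := C * (2 * ((Real.exp (4 * r * k)).toNNReal * Z)) with hM
  refine ⟨15 * (NNReal.sqrt M + 1), ?_, fun U V hlt => ?_⟩
  · have : (1 : ℝ≥0) ≤ NNReal.sqrt M + 1 := by simp
    calc (1 : ℝ≥0) ≤ 15 * 1 := by norm_num
      _ ≤ _ := by gcongr
  -- A common site contributes `1` to the exponential sum.
  have hUV : Disjoint U V := by
    by_contra h
    have h1 : (1 : ℝ≥0∞) ≤ expSum G r U V := one_le_expSum_of_not_disjoint h
    have h2 : (1 : ℝ≥0∞) ≤ ((15 * (NNReal.sqrt M + 1) : ℝ≥0) : ℝ≥0∞) := by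
      have : (1 : ℝ≥0) ≤ 15 * (NNReal.sqrt M + 1) :=
        one_le_mul_of_one_le_of_one_le (by norm_num) (by simp)
      exact_mod_cast this
    exact hlt.not_ge (one_le_mul h1 h2 |>.trans_eq (mul_comm _ _))
  have hfin : expSum G r U V ≠ ⊤ := by
    intro h
    rw [h, ENNReal.mul_top (by positivity)] at hlt
    exact not_top_lt hlt
  lift expSum G r U V to ℝ≥0 using hfin with σ hσ
  set T : ℝ := (Real.sqrt M + 1) * σ with hT
  have hT0 : 0 ≤ T := by positivity
  have hT1 : 15 * T < 1 := by
    have h : 15 * (NNReal.sqrt M + 1) * σ < 1 := by exact_mod_cast hlt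
    have h' : (15 * (Real.sqrt M + 1) * σ : ℝ) < 1 := by
      have := NNReal.coe_lt_coe.2 h
      simpa using this
    rw [hT]; linarith
  unfold mixingCoeff
  refine iSup₂_le fun A B => iSup₂_le fun hA hB => iSup₂_le fun hA0 hB0 => ?_
  have hα : 0 < μ.real A := ENNReal.toReal_pos hA0.ne' (measure_ne_top _ _)
  have hβ : 0 < μ.real B := ENNReal.toReal_pos hB0.ne' (measure_ne_top _ _)
  -- The strict inequality `T < s` leaves room for the truncation error, also when `T = 0`.
  have key : ∀ s : ℝ, T < s → s ≤ 1 / 10 →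
      |μ.real (A ∩ B) - μ.real A * μ.real B| ≤ 15 * s * (μ.real A * μ.real B) := by
    intro s hTs hs1
    have hs0 : 0 < s := hT0.trans_lt hTs
    refine abs_sub_le_of_forall_finset μ (cylinderEvents_le_pi _ hB) (by positivity)
      (fun F hF A' hA' => ?_) hA
    rcases eq_or_ne (μ A') 0 with h0 | h0
    · rw [measureReal_def, measureReal_def (s := A'),
        measure_mono_null Set.inter_subset_left h0, h0]
      simp
    refine hk.abs_sub_le_of_expSum_lt hconn hdeg hφ ha hZ F.finite_toSet (hUV.mono_left hF) hs0 hs1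
      ?_ hA' hB (pos_iff_ne_zero.2 h0) hB0
    rw [hsub]
    have hσF : expSum G (4 * r / 2) (F : Set S) V ≤ (σ : ℝ≥0∞) ^ 2 := by
      rw [show 4 * r / 2 = 2 * r by ring, hσ]
      exact (expSum_two_mul_le_sq r _ V).trans (by gcongr; exact expSum_mono_left r hF V)
    have hMs : (M : ℝ) * (σ : ℝ) ^ 2 < s ^ 2 := by
      have h1 : (M : ℝ) * (σ : ℝ) ^ 2 = (Real.sqrt M * σ) ^ 2 := by
        rw [mul_pow, Real.sq_sqrt M.coe_nonneg]
      rw [h1]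
      have h2 : Real.sqrt M * σ ≤ T := by
        rw [hT]
        exact mul_le_mul_of_nonneg_right (by linarith) σ.coe_nonneg
      exact pow_lt_pow_left₀ (h2.trans_lt hTs) (by positivity) two_ne_zero
    calc (C : ℝ≥0∞) * (2 * (ENNReal.ofReal (Real.exp (4 * r * k)) * Z *
          expSum G (4 * r / 2) (F : Set S) V))
        ≤ C * (2 * (ENNReal.ofReal (Real.exp (4 * r * k)) * Z * (σ : ℝ≥0∞) ^ 2)) := by gcongr
      _ = ((M * σ ^ 2 : ℝ≥0) : ℝ≥0∞) := by
          rw [hM, ENNReal.ofReal]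
          push_cast
          ring
      _ = ENNReal.ofReal ((M : ℝ) * (σ : ℝ) ^ 2) := by
          rw [← ENNReal.ofReal_coe_nnreal]
          push_cast
          rfl
      _ < ENNReal.ofReal (s ^ 2) := (ENNReal.ofReal_lt_ofReal_iff (by positivity)).2 hMs
  have hψ : psiDep μ A B / 15 ≤ T := by
    have hkey : ∀ s : ℝ, T < s → s ≤ 1 / 10 → psiDep μ A B / 15 ≤ s := by
      intro s hs hs1
      have hpos : 0 < μ.real A * μ.real B := mul_pos hα hβ
      have h1 : psiDep μ A B =
          |μ.real (A ∩ B) - μ.real A * μ.real B| / (μ.real A * μ.real B) := by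
        rw [psiDep, ← abs_of_pos hpos, ← abs_div, abs_of_pos hpos, sub_div, div_self hpos.ne']
      rw [h1, div_le_iff₀ (by norm_num), div_le_iff₀ hpos]
      linarith [key s hs hs1]
    refine le_of_forall_gt_imp_ge_of_dense fun s hs => ?_
    rcases le_total s (1 / 10) with h | h
    · exact hkey s hs h
    · exact (hkey (1 / 10) (by linarith) le_rfl).trans h
  calc ENNReal.ofReal (psiDep μ A B) ≤ ENNReal.ofReal (15 * T) :=
        ENNReal.ofReal_le_ofReal (by linarith)
    _ = ((15 * (NNReal.sqrt M + 1) * σ : ℝ≥0) : ℝ≥0∞) := by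
        rw [← ENNReal.ofReal_coe_nnreal]
        congr 1
        push_cast
        rw [hT]
        ring
    _ = _ := by push_cast; rfl
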